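/- Conventions. A graph $\Gamma$ consists of a vertex set $V$, a set $\vec E$ of directed edges with a fixed-point-free involution $e\mapsto e^{-1}$, and a terminus map $\tau:\vec E\to V$; loops and multiple edges are allowed. Automorphisms are pairs of bijections of $V$ and $\vec E$ commuting with these maps, and for a colouring $c$ of $\vec E$, $\mathrm{Aut}_c(\Gamma)$ is the group of automorphisms preserving $c$. For a cardinal $n$, $\Gamma$ is $n$-Cayley over a subgroup $H\le\mathrm{Aut}(\Gamma)$ if $H$ acts freely (semi-regularly) on $V$ with exactly $n$ orbits; bi-Cayley means $2$-Cayley over some $H$. (Vertex-transitivity of $\Gamma$ is not required.) A group acts regularly on a non-empty set of vertices if it preserves it and acts freely and transitively on it. Partite presentations. A partite presentation $P=\langle X\mid\mathcal U\mid\mathcal I\mid\phi\mid\mathcal R\rangle$ consists of a set $X$; a set $\mathcal S=\mathcal U\sqcup\mathcal I$ of generators, with the group $MF_P=\langle\mathcal S\mid s^2\ (s\in\mathcal I)\rangle$; a map $\phi:\mathcal S\to\mathrm{Sym}_X$ such that $\phi(s)$ is a fixed-point-free involution for $s\in\mathcal I$ and the right action $x\cdot(s_1\cdots s_n)=\phi(s_n)\circ\cdots\circ\phi(s_1)(x)$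 of $MF_P$ on $X$ is transitive; and for each $x\in X$ a set $\mathcal R_x\subseteq W_{x,x}$, where $W_{x,y}=\{w\in MF_P: x\cdot w=y\}$. Put $R_x=\langle wrw^{-1}: y\in X,\ w\in W_{x,y},\ r\in\mathcal R_y\rangle\trianglelefteq W_{x,x}$ and let $G_x=W_{x,x}/R_x$ be the vertex group. Let $T_P$ be the tree with vertex set $MF_P$ and directed edges $(w,ws)$, $s\in\mathcal S\cup\mathcal S^{-1}$, coloured by $c(w,ws)=s$. Fix $b\in X$, let $\tilde V_x=W_{b,x}$, and write $u\sim v$ if $u,v\in\tilde V_x$ and $u^{-1}v\in R_x$ for some $x$; two edges are equivalent if they have the same colour and equivalent initial and terminal vertices. The partite Cayley graph $\mathrm{Sp}(P)$ is $T_P/\!\sim$, with the induced colouring $c$, and $V_x$ is the image of $\tilde V_x$. 2-partite presentations. A 2-partite presentation $P=\langle\mathcal S_1,\mathcal U,\mathcal I\mid\mathcal R_0,\mathcal R_1\rangle$ consists of pairwise disjoint sets $\mathcal S_1,\mathcal U,\mathcal I$ with $\mathcal S_2=\mathcal U\cup\mathcal I\neq\emptyset$, and two sets $\mathcal R_0,\mathcal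 R_1\subseteq K$, where $MF_P=\langle\mathcal S_1\cup\mathcal S_2\mid s^2\ (s\in\mathcal I)\rangle$ and $K$ is the kernel of the homomorphism $MF_P\to\mathbb Z/2$ sending $\mathcal S_1$ to $0$ and $\mathcal S_2$ to $1$. For $i\in\mathbb Z/2$, $R_i$ is the normal closure in $K$ of $\mathcal R_i\cup\{srs^{-1}: r\in\mathcal R_{i+1},\ s\in\mathcal S_2\}$, $G_i=K/R_i$, $\tilde V_0=K$ and $\tilde V_1=MF_P\setminus K=\mathcal S_2K$; $\sim$, $\mathrm{Sp}(P)=T_P/\!\sim$, $c$ and $V_i$ are defined as above. Proposition. (1) Let $P$ be a partite presentation, $b,x\in X$ and $p\in\tilde V_x$. There is an injective homomorphism $\iota:G_x\to\mathrm{Aut}_c(\mathrm{Sp}(P))$, given on vertices by $\iota(gR_x)[h]=[pgp^{-1}h]$ for $g\in W_{x,x}$ and $h\in MF_P$. Through $\iota$, $G_x$ acts regularly on $V_x$, and in fact on $V_y$ for every $y\in X$; hence $\mathrm{Sp}(P)$ is $|X|$-Cayley over the image of $G_x$. (2) Let $P$ be a 2-partite presentation, $i\in\mathbb Z/2$ and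 $p\in\tilde V_i$. There is an injective homomorphism $\iota:G_i\to\mathrm{Aut}_c(\mathrm{Sp}(P))$, given on vertices by $\iota(gR_i)[h]=[pgp^{-1}h]$ for $g\in K$ and $h\in MF_P$. Through $\iota$, $G_i$ acts regularly on $V_i$ and on $V_{i+1}$, and $\mathrm{Sp}(P)$ is $2$-Cayley over its image. Moreover $G_0\cong G_1$; in particular every 2-partite Cayley graph is bi-Cayley. -/

import Mathlib

universe u v w

/-! ### Graphs with directed edges, automorphisms, `n`-Cayley graphs -/

/-- A graph with vertex set `V` and set of directed edges `E`: a fixed-point-free involution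
(edge reversal) and a terminus map. Loops and multiple edges are allowed. -/
structure DirGraph (V : Type u) (E : Type v) where
  inv : E → E
  inv_inv : ∀ e, inv (inv e) = e
  inv_ne : ∀ e, inv e ≠ e
  τ : E → V

namespace DirGraph

variable {V : Type u} {E : Type v}

/-- The automorphism group: pairs of bijections of the vertices and of the directed edges that
commute with reversal and with the terminus map. -/
def Aut (Γ : DirGraph V E) : Subgroup (Equiv.Perm V × Equiv.Perm E) where
  carrier := {f | (∀ e, f.2 (Γ.inv e) = Γ.inv (f.2 e)) ∧ ∀ e, f.1 (Γ.τ e) = Γ.τ (f.2 e)}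
  one_mem' := ⟨fun _ => rfl, fun _ => rfl⟩
  mul_mem' := by
    rintro f g ⟨hf, hf'⟩ ⟨hg, hg'⟩
    refine ⟨fun e => ?_, fun e => ?_⟩
    · simp [hf, hg]
    · simp [hf', hg']
  inv_mem' := by
    rintro f ⟨hf, hf'⟩
    refine ⟨fun e => ?_, fun e => ?_⟩
    · apply f.2.injective
      rw [hf]
      simp
    · apply f.1.injective
      rw [hf']
      simp

/-- Automorphisms act on the vertices. -/
instance (Γ : DirGraph V E) : MulAction Γ.Aut V where
  smul f x := f.1.1 x
  one_smul _ := rfl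
  mul_smul _ _ _ := rfl

/-- The group of automorphisms preserving a colouring `c` of the directed edges. -/
def AutCol {C : Type w} (Γ : DirGraph V E) (c : E → C) : Subgroup Γ.Aut where
  carrier := {f | ∀ e, c (f.1.2 e) = c e}
  one_mem' := fun _ => rfl
  mul_mem' := by
    intro f g hf hg e
    exact (hf (g.1.2 e)).trans (hg e)
  inv_mem' := by
    intro f hf e
    have h : c (f.1.2 (f.1.2⁻¹ e)) = c (f.1.2⁻¹ e) := hf _
    have h' : f.1.2 (f.1.2⁻¹ e) = e := by simp
    rw [h'] at h
    exact h.symm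

/-- `Γ` is `n`-Cayley over the group `H` of automorphisms: `H` acts semi-regularly (freely) on the
vertices, with exactly `n` orbits. -/
def IsNCayleyOver (Γ : DirGraph V E) (H : Subgroup Γ.Aut) (n : Cardinal.{w}) : Prop :=
  (∀ g ∈ H, ∀ h ∈ H, ∀ x : V, g • x = h • x → g = h) ∧
    Cardinal.lift.{w} (Cardinal.mk (MulAction.orbitRel.Quotient H V)) = Cardinal.lift.{u} n

/-- `Γ` is `n`-Cayley. -/
def IsNCayley (Γ : DirGraph V E) (n : Cardinal.{w}) : Prop :=
  ∃ H : Subgroup Γ.Aut, Γ.IsNCayleyOver H n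

/-- `Γ` is bi-Cayley. -/
def IsBiCayley (Γ : DirGraph V E) : Prop := Γ.IsNCayley (2 : Cardinal.{0})

end DirGraph

/-- The action of `G` on `V` restricts to a regular (free and transitive) action on the non-empty
subset `A`. -/
def ActsRegularlyOn (G : Type u) [Group G] {V : Type v} [MulAction G V] (A : Set V) : Prop :=
  A.Nonempty ∧ (∀ g : G, ∀ x ∈ A, g • x ∈ A) ∧ ∀ x ∈ A, ∀ y ∈ A, ∃! g : G, g • x = y

/-! ### The group `MF = ⟨U ∪ I | s² (s ∈ I)⟩`, its tree, and coloured quotients of the tree -/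

/-- The free product of an infinite cyclic group for each `s ∈ U` and a group of order two for
each `s ∈ I`, given by the presentation `⟨U ⊔ I | s² (s ∈ I)⟩`. -/
abbrev MF (U : Type v) (I : Type w) : Type (max v w) :=
  PresentedGroup {r : FreeGroup (U ⊕ I) | ∃ i : I, r = FreeGroup.of (Sum.inr i) ^ 2}

namespace MF

variable {U : Type v} {I : Type w}

/-- The generator `s` as an element of `MF`. -/
def gen (s : U ⊕ I) : MF U I := PresentedGroup.of s

/-- The homomorphism out of `MF` given by the images of the generators. -/
def lift {G : Type u} [Group G] (f : U ⊕ I → G) (hf : ∀ i, f (Sum.inr i) ^ 2 = 1) : MF U I →* G :=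
  PresentedGroup.toGroup (f := f) (by rintro r ⟨i, rfl⟩; simp [hf i])

theorem lift_gen {G : Type u} [Group G] (f : U ⊕ I → G) (hf : ∀ i, f (Sum.inr i) ^ 2 = 1)
    (s : U ⊕ I) : lift f hf (gen s) = f s :=
  PresentedGroup.toGroup.of _

theorem gen_inl_sq_ne (a : U) : gen (Sum.inl a : U ⊕ I) ^ 2 ≠ 1 := by
  intro h
  let F : MF U I →* Multiplicative ℤ :=
    lift (Sum.elim (fun _ => Multiplicative.ofAdd 1) (fun _ => 1)) (by simp)
  have hF : F (gen (Sum.inl a)) = Multiplicative.ofAdd 1 := lift_gen _ _ _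
  have h' := congrArg F h
  rw [map_pow, hF, F.map_one] at h'
  exact absurd h' (by decide)

theorem gen_ne_one (s : U ⊕ I) : gen s ≠ 1 := by
  rcases s with a | i
  · intro h
    exact gen_inl_sq_ne (I := I) a (by rw [h, one_pow])
  · intro h
    let F : MF U I →* Multiplicative (ZMod 2) :=
      lift (Sum.elim (fun _ => 1) (fun _ => Multiplicative.ofAdd 1)) (fun _ => by
        simp only [Sum.elim_inr]; decide)
    have hF : F (gen (Sum.inr i)) = Multiplicative.ofAdd 1 := lift_gen _ _ _
    have h' := congrArg F h
    rw [hF, F.map_one] at h'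
    exact absurd h' (by decide)

/-- The subset `S ∪ S⁻¹` of `MF`, where `S` is the set of generators; these are the colours. -/
def Letter (U : Type v) (I : Type w) : Type (max v w) :=
  {g : MF U I // ∃ s : U ⊕ I, g = gen s ∨ g = (gen s)⁻¹}

/-- Inversion of letters. -/
def Letter.inv (s : Letter U I) : Letter U I :=
  ⟨s.1⁻¹, by
    obtain ⟨t, h | h⟩ := s.2
    · exact ⟨t, Or.inr (by rw [h])⟩
    · exact ⟨t, Or.inl (by rw [h, inv_inv])⟩⟩

theorem Letter.ne_one (s : Letter U I) : s.1 ≠ 1 := by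
  obtain ⟨t, h | h⟩ := s.2
  · rw [h]; exact gen_ne_one t
  · rw [h]; exact inv_ne_one.2 (gen_ne_one t)

/-- The tree with vertex set `MF` and directed edges `(w, ws)` for `w ∈ MF`, `s ∈ S ∪ S⁻¹`. The
edge `(w, ws)` is recorded as the pair of `w` and `s`. -/
def tree (U : Type v) (I : Type w) : DirGraph (MF U I) (MF U I × Letter U I) where
  inv e := (e.1 * e.2.1, e.2.inv)
  inv_inv e := by
    refine Prod.ext ?_ (Subtype.ext ?_)
    · exact mul_inv_cancel_right _ _
    · exact inv_inv _
  inv_ne e h := e.2.ne_one (mul_eq_left.1 (congrArg Prod.fst h))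
  τ e := e.1 * e.2.1

/-- The colouring `c(w, ws) = s` of the tree. -/
def treeColour (e : MF U I × Letter U I) : Letter U I := e.2

/-- Extension of an equivalence relation on the vertices of the tree to its edges: two edges are
equivalent if they have the same colour and equivalent end-vertices. -/
def edgeSetoid (r : Setoid (MF U I)) : Setoid (MF U I × Letter U I) where
  r e f := treeColour e = treeColour f ∧ r ((tree U I).τ e) ((tree U I).τ f) ∧
    r ((tree U I).τ ((tree U I).inv e)) ((tree U I).τ ((tree U I).inv f))
  iseqv :=
    { refl := fun _ => ⟨rfl, r.refl _, r.refl _⟩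
      symm := fun h => ⟨h.1.symm, r.symm h.2.1, r.symm h.2.2⟩
      trans := fun h k => ⟨h.1.trans k.1, r.trans h.2.1 k.2.1, r.trans h.2.2 k.2.2⟩ }

/-- The quotient of the tree by an equivalence relation that never identifies the two ends of an
edge coloured by an element of `I` (so that no edge is identified with its reverse). -/
def quotGraph (r : Setoid (MF U I)) (hr : ∀ (i : I) (x : MF U I), ¬ r x (x * gen (Sum.inr i))) :
    DirGraph (Quotient r) (Quotient (edgeSetoid r)) where
  inv := Quotient.map (tree U I).inv (by
    rintro e f ⟨h1, h2, h3⟩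
    refine ⟨congrArg Letter.inv h1, h3, ?_⟩
    rw [(tree U I).inv_inv, (tree U I).inv_inv]
    exact h2)
  inv_inv e := by
    induction e using Quotient.inductionOn with
    | h e => simp [Quotient.map_mk, (tree U I).inv_inv]
  inv_ne e := by
    induction e using Quotient.inductionOn with
    | h e =>
      intro h
      obtain ⟨h1, h2, h3⟩ := Quotient.exact h
      obtain ⟨x, s⟩ := e
      have h1 : s.1⁻¹ = s.1 := congrArg Subtype.val h1
      have h3 : r (x * s.1 * s.1⁻¹) (x * s.1) := by
        rw [(tree U I).inv_inv] at h3
        exact r.symm (by simpa [tree, Letter.inv] using h3)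
      rw [mul_inv_cancel_right] at h3
      have hs : ∃ t : U ⊕ I, s.1 = gen t := by
        obtain ⟨t, ht | ht⟩ := s.2
        · exact ⟨t, ht⟩
        · exact ⟨t, by rw [← h1, ht, inv_inv]⟩
      obtain ⟨t, ht⟩ := hs
      rw [ht] at h1 h3
      rcases t with a | i
      · exact gen_inl_sq_ne (I := I) a (by rw [sq]; nth_rewrite 1 [← h1]; simp)
      · exact hr i x h3
  τ := Quotient.map (tree U I).τ (fun _ _ h => h.2.1)

/-- The colouring of the quotient graph induced by the colouring of the tree. -/
def quotColour (r : Setoid (MF U I)) : Quotient (edgeSetoid r) → Letter U I :=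
  Quotient.lift treeColour (fun _ _ h => h.1)

end MF

/-! ### Partite presentations -/

/-- The right action of `MF` on `X` given by a map from the generators to the permutations of `X`:
`x · (s₁ ⋯ sₙ) = φ(sₙ) (⋯ (φ(s₁) x))`. -/
def rightAct {X : Type u} {U : Type v} {I : Type w} (φ : U ⊕ I → Equiv.Perm X)
    (hφ : ∀ i, φ (Sum.inr i) ^ 2 = 1) : MF U I →* (Equiv.Perm X)ᵐᵒᵖ :=
  MF.lift (fun s => MulOpposite.op (φ s)) (fun i => by
    rw [← MulOpposite.op_pow, hφ i, MulOpposite.op_one])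

/-- A partite presentation `⟨X | U | I | φ | R⟩`. -/
structure PartitePresentation (X : Type u) (U : Type v) (I : Type w) where
  φ : U ⊕ I → Equiv.Perm X
  /-- for `s ∈ I`, the permutation `φ s` is an involution ... -/
  φ_sq : ∀ i, φ (Sum.inr i) ^ 2 = 1
  /-- ... without fixed points -/
  φ_ne : ∀ i x, φ (Sum.inr i) x ≠ x
  /-- the action on `X` is transitive -/
  transitive : ∀ x y : X, ∃ g : MF U I, (rightAct φ φ_sq g).unop x = y
  /-- the relator sets, -/
  rel : X → Set (MF U I)
  /-- which consist of elements of the stabilisers -/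
  rel_stab : ∀ x, ∀ r ∈ rel x, (rightAct φ φ_sq r).unop x = x

namespace PartitePresentation

variable {X : Type u} {U : Type v} {I : Type w} (P : PartitePresentation X U I)

/-- `P.act x g` is the vertex class `x · g` reached from `x` along the word `g`. -/
def act (x : X) (g : MF U I) : X := (rightAct P.φ P.φ_sq g).unop x

theorem act_one (x : X) : P.act x 1 = x := by simp [act]

theorem act_mul (x : X) (g h : MF U I) : P.act x (g * h) = P.act (P.act x g) h := by
  simp [act]

theorem act_gen (x : X) (s : U ⊕ I) : P.act x (MF.gen s) = P.φ s x := by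
  simp [act, rightAct, MF.lift_gen]

theorem act_inv {x y : X} {g : MF U I} (h : P.act x g = y) : P.act y g⁻¹ = x := by
  rw [← h, ← act_mul, mul_inv_cancel, act_one]

/-- `W x y` is the set of words leading from the class `x` to the class `y`. -/
def W (x y : X) : Set (MF U I) := {g | P.act x g = y}

/-- The stabiliser `W x x` of the class `x`. -/
def stab (x : X) : Subgroup (MF U I) where
  carrier := P.W x x
  one_mem' := P.act_one x
  mul_mem' := by
    intro g h (hg : P.act x g = x) (hh : P.act x h = x)
    change P.act x (g * h) = x
    rw [act_mul, hg, hh]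
  inv_mem' := fun h => P.act_inv h

/-- `R_x = ⟨g r g⁻¹ | y ∈ X, g ∈ W x y, r ∈ rel y⟩`. -/
def relSub (x : X) : Subgroup (MF U I) :=
  Subgroup.closure {k | ∃ y, ∃ g ∈ P.W x y, ∃ r ∈ P.rel y, k = g * r * g⁻¹}

theorem relSub_le (x : X) : P.relSub x ≤ P.stab x := by
  refine (Subgroup.closure_le _).2 ?_
  rintro k ⟨y, g, hg, r, hr, rfl⟩
  change P.act x (g * r * g⁻¹) = x
  have hg : P.act x g = y := hg
  have hr : P.act y r = y := P.rel_stab y r hr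
  rw [act_mul, act_mul, hg, hr, P.act_inv hg]

theorem conj_mem_relSub {x y : X} {g k : MF U I} (hg : P.act x g = y) (hk : k ∈ P.relSub y) :
    g * k * g⁻¹ ∈ P.relSub x := by
  have h : P.relSub y ≤ (P.relSub x).comap (MulAut.conj g).toMonoidHom := by
    refine (Subgroup.closure_le _).2 ?_
    rintro k ⟨z, a, ha, r, hr, rfl⟩
    have ha : P.act y a = z := ha
    refine Subgroup.subset_closure ⟨z, g * a, ?_, r, hr, ?_⟩
    · change P.act x (g * a) = z
      rw [act_mul, hg, ha]
    · simp [mul_assoc]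
  exact h hk

instance (x : X) : ((P.relSub x).subgroupOf (P.stab x)).Normal where
  conj_mem _ hk g := P.conj_mem_relSub g.2 hk

/-- The vertex group `G_x = W x x / R_x`. -/
abbrev VertexGroup (x : X) : Type (max v w) := P.stab x ⧸ (P.relSub x).subgroupOf (P.stab x)

/-- The class `Ṽ_x = W b x` of vertices of the tree, for the base class `b`. -/
def treeClass (b x : X) : Set (MF U I) := P.W b x

/-- The equivalence relation on the vertices of the tree: `g ∼ h` if `g` and `h` lie in the same
class `Ṽ_x` and `g⁻¹ h ∈ R_x`. -/
def vertexSetoid (b : X) : Setoid (MF U I) where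
  r g h := ∃ x, g ∈ P.treeClass b x ∧ h ∈ P.treeClass b x ∧ g⁻¹ * h ∈ P.relSub x
  iseqv :=
    { refl := fun g => ⟨P.act b g, rfl, rfl, by simp⟩
      symm := by
        rintro g h ⟨x, hg, hh, hk⟩
        refine ⟨x, hh, hg, ?_⟩
        have := inv_mem hk
        rwa [mul_inv_rev, inv_inv] at this
      trans := by
        rintro g h k ⟨x, hg, hh, h1⟩ ⟨y, hh', hk, h2⟩
        obtain rfl : x = y := Eq.trans (Eq.symm hh) hh'
        refine ⟨x, hg, hk, ?_⟩
        have := mul_mem h1 h2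
        rwa [mul_assoc, mul_inv_cancel_left] at this }

theorem not_rel_gen (b : X) (i : I) (g : MF U I) :
    ¬ P.vertexSetoid b g (g * MF.gen (Sum.inr i)) := by
  rintro ⟨x, hg, hh, -⟩
  have hg : P.act b g = x := hg
  have hh : P.act b (g * MF.gen (Sum.inr i)) = x := hh
  rw [act_mul, hg, act_gen] at hh
  exact P.φ_ne i x hh

/-- Vertices of the partite Cayley graph. -/
abbrev Vert (b : X) : Type (max v w) := Quotient (P.vertexSetoid b)

/-- Directed edges of the partite Cayley graph. -/
abbrev Edge (b : X) : Type (max v w) := Quotient (MF.edgeSetoid (P.vertexSetoid b))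

/-- The partite Cayley graph of `P` (with base class `b`). -/
def cayley (b : X) : DirGraph (P.Vert b) (P.Edge b) :=
  MF.quotGraph (P.vertexSetoid b) (P.not_rel_gen b)

/-- The colouring of the partite Cayley graph by `S ∪ S⁻¹`. -/
def colour (b : X) : P.Edge b → MF.Letter U I := MF.quotColour (P.vertexSetoid b)

/-- The vertex of the partite Cayley graph represented by `g`. -/
def vert (b : X) (g : MF U I) : P.Vert b := Quotient.mk _ g

/-- The vertex class `V_x` of the partite Cayley graph. -/
def vertexClass (b x : X) : Set (P.Vert b) := P.vert b '' P.treeClass b x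

end PartitePresentation

/-! ### 2-partite presentations -/

/-- The homomorphism from `MF` to `ℤ/2` that counts, modulo two, the letters from `U ∪ I`
(as opposed to `S₁`). -/
def twoDeg (S₁ : Type u) (U : Type v) (I : Type w) : MF (S₁ ⊕ U) I →* Multiplicative (ZMod 2) :=
  MF.lift (Sum.elim (Sum.elim (fun _ => 1) (fun _ => Multiplicative.ofAdd 1))
    (fun _ => Multiplicative.ofAdd 1)) (fun _ => by simp only [Sum.elim_inr]; decide)

/-- A 2-partite presentation `⟨S₁, U, I | R₀, R₁⟩`, with relator sets in the kernel `K`. -/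
structure TwoPartitePresentation (S₁ : Type u) (U : Type v) (I : Type w) where
  rel : ZMod 2 → Set (MF (S₁ ⊕ U) I)
  rel_ker : ∀ i, ∀ r ∈ rel i, r ∈ (twoDeg S₁ U I).ker

namespace TwoPartitePresentation

variable {S₁ : Type u} {U : Type v} {I : Type w} (P : TwoPartitePresentation S₁ U I)

/-- The kernel `K`. -/
abbrev K (_P : TwoPartitePresentation S₁ U I) : Subgroup (MF (S₁ ⊕ U) I) := (twoDeg S₁ U I).ker

/-- The generators in `S₂ = U ∪ I`, as elements of `MF`. -/
def gen₂ : U ⊕ I → MF (S₁ ⊕ U) I :=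
  Sum.elim (fun a => MF.gen (Sum.inl (Sum.inr a))) (fun i => MF.gen (Sum.inr i))

/-- `R_i` is the normal closure in `K` of `rel i ∪ {s r s⁻¹ | r ∈ rel (i + 1), s ∈ S₂}`. -/
def relSub (i : ZMod 2) : Subgroup P.K :=
  Subgroup.normalClosure
    {k | (k : MF (S₁ ⊕ U) I) ∈ P.rel i ∨
      ∃ r ∈ P.rel (i + 1), ∃ s : U ⊕ I, (k : MF (S₁ ⊕ U) I) = gen₂ s * r * (gen₂ s)⁻¹}

instance (i : ZMod 2) : (P.relSub i).Normal := Subgroup.normalClosure_normal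

/-- The vertex group `G_i = K / R_i`. -/
abbrev VertexGroup (i : ZMod 2) : Type (max u v w) := P.K ⧸ P.relSub i

/-- The coset `Ṽ_i` of `K`: `Ṽ_0 = K`, and `Ṽ_1` is its complement `S₂ K`. -/
def treeClass (_P : TwoPartitePresentation S₁ U I) (i : ZMod 2) : Set (MF (S₁ ⊕ U) I) :=
  {g | twoDeg S₁ U I g = Multiplicative.ofAdd i}

/-- The equivalence relation on the vertices of the tree: `g ∼ h` if `g` and `h` lie in the same
class `Ṽ_i` and `g⁻¹ h ∈ R_i`. -/
def vertexSetoid : Setoid (MF (S₁ ⊕ U) I) where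
  r g h := ∃ i, g ∈ P.treeClass i ∧ h ∈ P.treeClass i ∧ g⁻¹ * h ∈ (P.relSub i).map P.K.subtype
  iseqv :=
    { refl := fun g => ⟨Multiplicative.toAdd (twoDeg S₁ U I g), rfl, rfl, by
        rw [inv_mul_cancel]; exact one_mem _⟩
      symm := by
        rintro g h ⟨x, hg, hh, hk⟩
        refine ⟨x, hh, hg, ?_⟩
        have := inv_mem hk
        rwa [mul_inv_rev, inv_inv] at this
      trans := by
        rintro g h k ⟨x, hg, hh, h1⟩ ⟨y, hh', hk, h2⟩
        obtain rfl : x = y := Multiplicative.ofAdd.injective (Eq.trans (Eq.symm hh) hh')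
        refine ⟨x, hg, hk, ?_⟩
        have := mul_mem h1 h2
        rwa [mul_assoc, mul_inv_cancel_left] at this }

theorem not_rel_gen (i : I) (g : MF (S₁ ⊕ U) I) :
    ¬ P.vertexSetoid g (g * MF.gen (Sum.inr i)) := by
  rintro ⟨x, hg, hh, -⟩
  have hg : twoDeg S₁ U I g = Multiplicative.ofAdd x := hg
  have hh : twoDeg S₁ U I (g * MF.gen (Sum.inr i)) = Multiplicative.ofAdd x := hh
  rw [map_mul, hg, mul_eq_left, twoDeg, MF.lift_gen] at hh
  simp only [Sum.elim_inr] at hh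
  exact absurd hh (by decide)

/-- Vertices of the 2-partite Cayley graph. -/
abbrev Vert : Type (max u v w) := Quotient P.vertexSetoid

/-- Directed edges of the 2-partite Cayley graph. -/
abbrev Edge : Type (max u v w) := Quotient (MF.edgeSetoid P.vertexSetoid)

/-- The 2-partite Cayley graph of `P`. -/
def cayley : DirGraph P.Vert P.Edge := MF.quotGraph P.vertexSetoid P.not_rel_gen

/-- The colouring of the 2-partite Cayley graph by `S ∪ S⁻¹`. -/
def colour : P.Edge → MF.Letter (S₁ ⊕ U) I := MF.quotColour P.vertexSetoid

/-- The vertex of the 2-partite Cayley graph represented by `g`. -/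
def vert (g : MF (S₁ ⊕ U) I) : P.Vert := Quotient.mk _ g

/-- The vertex class `V_i` of the 2-partite Cayley graph. -/
def vertexClass (i : ZMod 2) : Set P.Vert := P.vert '' P.treeClass i

end TwoPartitePresentation

/-!
The relation `g ∼ h` compares `g⁻¹ h` with a subgroup `R_x` depending on the class `x` of `h`.
Conjugation by `h` carries `R_x` onto `R_b` and `g⁻¹ h` to `h g⁻¹`, so `∼` is the right coset
relation of the single subgroup `R_b`, and the partite Cayley graph is the quotient of the tree by
the left translations in `R_b`. Since `R_b` is normal in the stabiliser `A` of the base class,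
`G_b = A / R_b` acts on this quotient; the action is free, and its vertex orbits correspond to the
right cosets of `A`, that is, to the classes. The action of `G_x` is the pullback along the
isomorphism `G_x ≃ G_b` given by conjugation by `p`.

In the 2-partite case `A = K`, and the classes are the two cosets of `K`.
-/

section FreeActions

variable {V : Type u} {X : Type w} {q : V → X}

theorem ActsRegularlyOn.of_orbitRel_eq_ker {G : Type v} [Group G] [MulAction G V]
    [IsCancelSMul G V] (hq : Function.Surjective q)
    (horb : MulAction.orbitRel G V = Setoid.ker q) (x : X) :
    ActsRegularlyOn G (q ⁻¹' {x}) := by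
  have orbit_iff (v w : V) : (∃ g : G, g • w = v) ↔ q v = q w := Setoid.ext_iff.1 horb v w
  refine ⟨hq x, fun g v hv => ((orbit_iff _ v).1 ⟨g, rfl⟩).trans hv, fun v hv w hw => ?_⟩
  obtain ⟨g, rfl⟩ := (orbit_iff w v).2 (hw.trans hv.symm)
  exact ⟨g, rfl, fun g' hg' => IsCancelSMul.right_cancel g' g v hg'⟩

theorem DirGraph.IsNCayleyOver.of_orbitRel_eq_ker {E : Type v} {Γ : DirGraph V E}
    {H : Subgroup Γ.Aut} [IsCancelSMul H V] (hq : Function.Surjective q)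
    (horb : MulAction.orbitRel H V = Setoid.ker q) : Γ.IsNCayleyOver H (Cardinal.mk X) := by
  refine ⟨fun f hf f' hf' v h => congrArg Subtype.val
    (IsCancelSMul.right_cancel (⟨f, hf⟩ : H) ⟨f', hf'⟩ v h), ?_⟩
  exact Cardinal.mk_congr_lift
    ((Quotient.congrRight (Setoid.ext_iff.1 horb)).trans (Setoid.quotientKerEquivOfSurjective q hq))

end FreeActions

namespace MF

variable {U : Type v} {I : Type w}

section Translations

variable (r : Setoid (MF U I)) (hr : ∀ (i : I) (x : MF U I), ¬ r x (x * gen (Sum.inr i)))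

theorem edgeSetoid_iff {e f : MF U I × Letter U I} :
    edgeSetoid r e f ↔ e.2 = f.2 ∧ r (e.1 * e.2.1) (f.1 * f.2.1) ∧ r e.1 f.1 := by
  have tau_inv (e : MF U I × Letter U I) : (tree U I).τ ((tree U I).inv e) = e.1 :=
    mul_inv_cancel_right _ _
  change _ ∧ _ ∧ _ ↔ _
  rw [tau_inv, tau_inv]
  rfl

/-- The group of the left translations of the tree that descend to its quotient by `r`. -/
def translationGroup : Subgroup (MF U I) where
  carrier := {a | ∀ g h, r (a * g) (a * h) ↔ r g h}
  one_mem' g h := by rw [one_mul, one_mul]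
  mul_mem' ha hb g h := by rw [mul_assoc, mul_assoc, ha, hb]
  inv_mem' {a} ha g h := by rw [← ha, mul_inv_cancel_left, mul_inv_cancel_left]

variable {r}

theorem autCol_quotGraph_ext {f f' : (quotGraph r hr).AutCol (quotColour r)}
    (hvert : ∀ g : MF U I, f.1.1.1 (Quotient.mk r g) = f'.1.1.1 (Quotient.mk r g))
    (hedge : ∀ e, f.1.1.2 (Quotient.mk (edgeSetoid r) e) = f'.1.1.2 (Quotient.mk _ e)) : f = f' :=
  Subtype.ext <| Subtype.ext <| Prod.ext
    (Equiv.ext fun v => v.inductionOn hvert) (Equiv.ext fun e => e.inductionOn hedge)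

/-- Left translation by `a` on the quotient of the tree by `r`. -/
def translation (a : translationGroup r) : (quotGraph r hr).AutCol (quotColour r) where
  val :=
    ⟨(Quotient.congr (Equiv.mulLeft a.1) fun g h => (a.2 g h).symm,
      Quotient.congr ((Equiv.mulLeft a.1).prodCongr (Equiv.refl _)) fun e f => by
        simp only [edgeSetoid_iff, Equiv.prodCongr_apply, Prod.map, Equiv.coe_mulLeft,
          Equiv.refl_apply, mul_assoc, a.2 _ _]),
      fun e => e.inductionOn fun e =>
        congrArg (Quotient.mk (edgeSetoid r)) (Prod.ext (mul_assoc a.1 e.1 e.2.1).symm rfl),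
      fun e => e.inductionOn fun e =>
        congrArg (Quotient.mk r) (mul_assoc a.1 e.1 e.2.1).symm⟩
  property e := e.inductionOn fun _ => rfl

/-- Left translations as a homomorphism into the colour-preserving automorphisms. -/
def translationHom : translationGroup r →* (quotGraph r hr).AutCol (quotColour r) where
  toFun := translation hr
  map_one' := autCol_quotGraph_ext hr (fun g => congrArg (Quotient.mk r) (one_mul g))
    fun e => congrArg (Quotient.mk _) (Prod.ext (one_mul e.1) rfl)
  map_mul' a b := autCol_quotGraph_ext hr (fun g => congrArg (Quotient.mk r) (mul_assoc a.1 b.1 g))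
    fun e => congrArg (Quotient.mk _) (Prod.ext (mul_assoc a.1 b.1 e.1) rfl)

theorem translationHom_eq_one {a : translationGroup r} (ha : ∀ g, r (a * g) g) :
    translationHom hr a = 1 :=
  autCol_quotGraph_ext hr (fun g => Quotient.sound (ha g)) fun e => Quotient.sound <|
    (edgeSetoid_iff r).2 ⟨rfl, (mul_assoc a.1 e.1 e.2.1).symm ▸ ha (e.1 * e.2.1), ha e.1⟩

end Translations

section CosetQuotient

variable {A : Subgroup (MF U I)} {N : Subgroup A} {r : Setoid (MF U I)}

theorem rel_mul_left_iff (hN : r = QuotientGroup.rightRel (N.map A.subtype)) (a : A) (g : MF U I) :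
    r (a * g) g ↔ a ∈ N := by
  rw [hN, QuotientGroup.rightRel_apply, mul_inv_rev, mul_inv_cancel_left, inv_mem_iff]
  exact Subgroup.mem_map_iff_mem A.subtype_injective

variable [N.Normal]

theorem le_translationGroup (hN : r = QuotientGroup.rightRel (N.map A.subtype)) :
    A ≤ translationGroup r := by
  intro a ha g h
  have ha_normalizer : a ∈ Subgroup.normalizer (N.map A.subtype : Set (MF U I)) :=
    Subgroup.le_normalizer_map A.subtype
      ⟨⟨a, ha⟩, (Subgroup.normalizer_eq_top N).symm ▸ Subgroup.mem_top _, rfl⟩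
  rw [hN, QuotientGroup.rightRel_apply, QuotientGroup.rightRel_apply,
    Subgroup.mem_normalizer_iff.1 ha_normalizer (h * g⁻¹)]
  simp only [mul_inv_rev, mul_assoc]

variable (hr : ∀ (i : I) (x : MF U I), ¬ r x (x * gen (Sum.inr i)))

/-- The action of `A / N` by left translations on the quotient of the tree by `N`. -/
def deckHom (hN : r = QuotientGroup.rightRel (N.map A.subtype)) :
    A ⧸ N →* (quotGraph r hr).AutCol (quotColour r) :=
  QuotientGroup.lift N ((translationHom hr).comp (Subgroup.inclusion (le_translationGroup hN)))
    fun a ha => translationHom_eq_one hr fun g => (rel_mul_left_iff hN a g).2 ha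

variable (hN : r = QuotientGroup.rightRel (N.map A.subtype))

theorem deckHom_mk_smul (a : A) (g : MF U I) :
    (deckHom hr hN (QuotientGroup.mk a)).1 • Quotient.mk r g = Quotient.mk r (a * g) :=
  rfl

theorem eq_one_of_deckHom_smul {x : A ⧸ N} {v : Quotient r} (h : (deckHom hr hN x).1 • v = v) :
    x = 1 := by
  induction x using QuotientGroup.induction_on with | H a =>
  induction v using Quotient.inductionOn with | h g =>
  exact (QuotientGroup.eq_one_iff a).2 ((rel_mul_left_iff hN a g).1 (Quotient.exact h))

theorem deckHom_injective : Function.Injective (deckHom hr hN) :=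
  (injective_iff_map_eq_one _).2 fun x hx =>
    eq_one_of_deckHom_smul hr hN (v := Quotient.mk r 1) (by rw [hx]; rfl)

/-- The group of the automorphisms of the quotient of the tree by `N` induced by elements of `A`. -/
def deckGroup : Subgroup (quotGraph r hr).Aut :=
  (deckHom hr hN).range.map ((quotGraph r hr).AutCol (quotColour r)).subtype

instance : IsCancelSMul (deckGroup hr hN) (Quotient r) := by
  refine isCancelSMul_iff_eq_one_of_smul_eq.2 ?_
  rintro ⟨_, _, ⟨x, rfl⟩, rfl⟩ v hv
  obtain rfl := eq_one_of_deckHom_smul hr hN hv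
  ext1
  simp

theorem orbitRel_deckGroup {X : Type*} {q : Quotient r → X}
    (hq : Setoid.ker (q ∘ Quotient.mk r) = QuotientGroup.rightRel A) :
    MulAction.orbitRel (deckGroup hr hN) (Quotient r) = Setoid.ker q := by
  have eq_iff (g h : MF U I) : q (Quotient.mk r g) = q (Quotient.mk r h) ↔ h * g⁻¹ ∈ A :=
    (Setoid.ext_iff.1 hq g h).trans QuotientGroup.rightRel_apply
  ext v w
  induction v using Quotient.inductionOn with | h g =>
  induction w using Quotient.inductionOn with | h h =>
  constructor
  · rintro ⟨⟨_, _, ⟨x, rfl⟩, rfl⟩, hx⟩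
    induction x using QuotientGroup.induction_on with | H a =>
    rw [← hx]
    exact ((eq_iff h (a * h)).2 (by simp)).symm
  · intro hgh
    have ha : g * h⁻¹ ∈ A := (eq_iff h g).1 hgh.symm
    exact ⟨⟨_, _, ⟨QuotientGroup.mk ⟨_, ha⟩, rfl⟩, rfl⟩,
      congrArg (Quotient.mk r) (inv_mul_cancel_right g h)⟩

section Range

variable {G : Type*} [Group G] (e : G ≃* A ⧸ N)

theorem map_range_deckHom_comp :
    ((deckHom hr hN).comp e.toMonoidHom).range.map
      ((quotGraph r hr).AutCol (quotColour r)).subtype = deckGroup hr hN := by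
  rw [MonoidHom.range_comp, MonoidHom.range_eq_top_of_surjective _ e.surjective,
    ← MonoidHom.range_eq_map, deckGroup]

variable {X : Type u} {q : Quotient r → X}

theorem actsRegularlyOn_range_deckHom_comp (hsurj : Function.Surjective q)
    (hq : Setoid.ker (q ∘ Quotient.mk r) = QuotientGroup.rightRel A) (x : X) :
    ActsRegularlyOn (((deckHom hr hN).comp e.toMonoidHom).range.map
      ((quotGraph r hr).AutCol (quotColour r)).subtype) (q ⁻¹' {x}) := by
  rw [map_range_deckHom_comp]
  exact .of_orbitRel_eq_ker hsurj (orbitRel_deckGroup hr hN hq) x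

theorem isNCayleyOver_range_deckHom_comp (hsurj : Function.Surjective q)
    (hq : Setoid.ker (q ∘ Quotient.mk r) = QuotientGroup.rightRel A) :
    (quotGraph r hr).IsNCayleyOver (((deckHom hr hN).comp e.toMonoidHom).range.map
      ((quotGraph r hr).AutCol (quotColour r)).subtype) (Cardinal.mk X) := by
  rw [map_range_deckHom_comp]
  exact .of_orbitRel_eq_ker hsurj (orbitRel_deckGroup hr hN hq)

end Range

end CosetQuotient

end MF

namespace PartitePresentation

variable {X : Type u} {U : Type v} {I : Type w} (P : PartitePresentation X U I)

theorem act_inv_eq_iff {x y : X} {g : MF U I} : P.act y g⁻¹ = x ↔ P.act x g = y :=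
  ⟨fun h => by simpa only [inv_inv] using P.act_inv h, P.act_inv⟩

theorem ker_act (b : X) : Setoid.ker (P.act b) = QuotientGroup.rightRel (P.stab b) := by
  ext g h
  have : h * g⁻¹ ∈ P.stab b ↔ P.act (P.act b h) g⁻¹ = b := by rw [← act_mul]; rfl
  rw [QuotientGroup.rightRel_apply, this, act_inv_eq_iff, Setoid.ker_def]

theorem conj_mem_stab_iff {x y : X} {g k : MF U I} (hg : P.act x g = y) :
    g * k * g⁻¹ ∈ P.stab x ↔ k ∈ P.stab y := by
  change P.act x (g * k * g⁻¹) = x ↔ P.act y k = y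
  rw [act_mul, act_mul, act_inv_eq_iff, hg, eq_comm]

theorem conj_mem_relSub_iff {x y : X} {g k : MF U I} (hg : P.act x g = y) :
    g * k * g⁻¹ ∈ P.relSub x ↔ k ∈ P.relSub y := by
  refine ⟨fun h => ?_, P.conj_mem_relSub hg⟩
  simpa [mul_assoc] using P.conj_mem_relSub (P.act_inv hg) h

theorem vertexSetoid_eq_rightRel (b : X) :
    P.vertexSetoid b = QuotientGroup.rightRel
      (((P.relSub b).subgroupOf (P.stab b)).map (P.stab b).subtype) := by
  rw [Subgroup.map_subgroupOf_eq_of_le (P.relSub_le b)]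
  ext g h
  have conj_eq : h * (g⁻¹ * h) * h⁻¹ = h * g⁻¹ := by group
  rw [QuotientGroup.rightRel_apply, ← conj_eq, P.conj_mem_relSub_iff rfl]
  refine ⟨fun ⟨x, _, hh, hk⟩ => (show P.act b h = x from hh) ▸ hk,
    fun hk => ⟨P.act b h, ?_, rfl, hk⟩⟩
  have hstab : h * g⁻¹ ∈ P.stab b := conj_eq ▸ (P.conj_mem_stab_iff rfl).2 (P.relSub_le _ hk)
  exact (Setoid.ext_iff.1 (P.ker_act b) g h).2 (QuotientGroup.rightRel_apply.2 hstab)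

/-- The index `y` of the class `V_y` that contains a given vertex of the partite Cayley graph. -/
def vertexLabel (b : X) : P.Vert b → X :=
  Quotient.lift (P.act b) fun _ _ ⟨_, hg, hh, _⟩ => Eq.trans hg (Eq.symm hh)

theorem vertexLabel_surjective (b : X) : Function.Surjective (P.vertexLabel b) :=
  fun y => (P.transitive b y).imp' (P.vert b) fun _ hg => hg

theorem vertexClass_eq_preimage (b y : X) : P.vertexClass b y = P.vertexLabel b ⁻¹' {y} :=
  Set.image_preimage_eq (P.vertexLabel b ⁻¹' {y}) Quotient.mk_surjective

section VertexGroup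

variable {P} {b x : X} {p : MF U I} (hp : P.act b p = x)

/-- Conjugation by a word from `b` to `x`, as an isomorphism from the stabiliser of `x` to that of
`b`. -/
def stabEquiv : P.stab x ≃* P.stab b where
  toFun g := ⟨p * g * p⁻¹, (P.conj_mem_stab_iff hp).2 g.2⟩
  invFun g := ⟨p⁻¹ * g * p, by
    simpa only [inv_inv] using (P.conj_mem_stab_iff (g := p⁻¹) (P.act_inv hp)).2 g.2⟩
  left_inv g := Subtype.ext (by simp [mul_assoc])
  right_inv g := Subtype.ext (by simp [mul_assoc])
  map_mul' g h := Subtype.ext (by simp [mul_assoc])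

/-- Conjugation by a word from `b` to `x`, as an isomorphism from `G_x` to `G_b`. -/
def vertexGroupEquiv : P.VertexGroup x ≃* P.VertexGroup b :=
  QuotientGroup.congr _ _ (stabEquiv hp) <| by
    have comap_eq : ((P.relSub b).subgroupOf (P.stab b)).comap (stabEquiv hp).toMonoidHom =
        (P.relSub x).subgroupOf (P.stab x) :=
      Subgroup.ext fun _ => P.conj_mem_relSub_iff hp
    rw [← comap_eq]
    exact Subgroup.map_comap_eq_self_of_surjective (stabEquiv hp).surjective _

end VertexGroup

theorem exists_vertexGroup_action {b x : X} {p : MF U I} (hp : p ∈ P.treeClass b x) :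
    ∃ ι : P.VertexGroup x →* (P.cayley b).AutCol (P.colour b),
      Function.Injective ι ∧
      (∀ (g : P.stab x) (h : MF U I),
        (ι (QuotientGroup.mk g)).1 • P.vert b h = P.vert b (p * g * p⁻¹ * h)) ∧
      (∀ y : X, ActsRegularlyOn
        (ι.range.map ((P.cayley b).AutCol (P.colour b)).subtype) (P.vertexClass b y)) ∧
      (P.cayley b).IsNCayleyOver
        (ι.range.map ((P.cayley b).AutCol (P.colour b)).subtype) (Cardinal.mk X) := by
  have hr := P.not_rel_gen b
  have hN := P.vertexSetoid_eq_rightRel b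
  have hlabel := P.vertexLabel_surjective b
  refine ⟨(MF.deckHom hr hN).comp (vertexGroupEquiv hp).toMonoidHom,
    (MF.deckHom_injective hr hN).comp (vertexGroupEquiv hp).injective,
    fun g h => MF.deckHom_mk_smul hr hN (stabEquiv hp g) h, fun y => ?_, ?_⟩
  · rw [vertexClass_eq_preimage]
    exact MF.actsRegularlyOn_range_deckHom_comp hr hN _ hlabel (P.ker_act b) y
  · exact MF.isNCayleyOver_range_deckHom_comp hr hN _ hlabel (P.ker_act b)

end PartitePresentation

namespace TwoPartitePresentation

variable {S₁ : Type u} {U : Type v} {I : Type w} (P : TwoPartitePresentation S₁ U I)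

theorem twoDeg_gen₂ (s : U ⊕ I) : twoDeg S₁ U I (gen₂ s) = Multiplicative.ofAdd 1 := by
  rcases s with a | i <;> simp [gen₂, twoDeg, MF.lift_gen]

theorem gen₂_mem_treeClass (s : U ⊕ I) : gen₂ s ∈ P.treeClass 1 :=
  twoDeg_gen₂ s

theorem one_mem_treeClass : 1 ∈ P.treeClass 0 :=
  map_one (twoDeg S₁ U I)

theorem gen₂_mul_gen₂_mem_K (s t : U ⊕ I) : gen₂ s * gen₂ t ∈ P.K := by
  rw [MonoidHom.mem_ker, map_mul, twoDeg_gen₂, twoDeg_gen₂]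
  decide

section Conjugation

variable {P} {i : ZMod 2} {g : MF (S₁ ⊕ U) I} {k : P.K}

theorem conjNormal_mem_relSub_iff_of_mem_K (hg : g ∈ P.K) :
    MulAut.conjNormal g k ∈ P.relSub i ↔ k ∈ P.relSub i := by
  lift g to P.K using hg
  rw [MulAut.conjNormal_val, MulAut.conj_apply,
    Subgroup.Normal.mem_comm_iff inferInstance, inv_mul_cancel_left]

theorem conjNormal_gen₂_mem_relSub (s : U ⊕ I) (hk : k ∈ P.relSub i) :
    MulAut.conjNormal (gen₂ s) k ∈ P.relSub (i + 1) := by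
  suffices P.relSub i ≤
      (P.relSub (i + 1)).comap (MulAut.conjNormal (H := P.K) (gen₂ s)).toMonoidHom from this hk
  refine Subgroup.normalClosure_le_normal ?_
  rintro k (hk | ⟨r, hr, t, hk⟩)
  · refine Subgroup.subset_normalClosure (Or.inr ⟨k, ?_, s, MulAut.conjNormal_apply _ _⟩)
    rwa [add_assoc, CharTwo.add_self_eq_zero, add_zero]
  · have conj_eq : MulAut.conjNormal (gen₂ s) k =
        MulAut.conjNormal (gen₂ s * gen₂ t) (⟨r, P.rel_ker _ r hr⟩ : P.K) := by
      ext1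
      simp only [MulAut.conjNormal_apply, hk, mul_inv_rev, mul_assoc]
    change MulAut.conjNormal (gen₂ s) k ∈ P.relSub (i + 1)
    rw [conj_eq, conjNormal_mem_relSub_iff_of_mem_K (P.gen₂_mul_gen₂_mem_K s t)]
    exact Subgroup.subset_normalClosure (Or.inl hr)

theorem conjNormal_gen₂_mem_relSub_iff (s : U ⊕ I) :
    MulAut.conjNormal (gen₂ s) k ∈ P.relSub (i + 1) ↔ k ∈ P.relSub i := by
  refine ⟨fun hk => ?_, conjNormal_gen₂_mem_relSub s⟩
  have hk' := conjNormal_gen₂_mem_relSub s hk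
  rwa [← MulAut.mul_apply, ← map_mul, add_assoc, CharTwo.add_self_eq_zero, add_zero,
    conjNormal_mem_relSub_iff_of_mem_K (P.gen₂_mul_gen₂_mem_K s s)] at hk'

theorem conjNormal_mem_relSub_zero_iff [Nonempty (U ⊕ I)] (hg : g ∈ P.treeClass i) :
    MulAut.conjNormal g k ∈ P.relSub 0 ↔ k ∈ P.relSub i := by
  have eq_zero_or_one (j : ZMod 2) : j = 0 ∨ j = 1 := by decide +revert
  rcases eq_zero_or_one i with rfl | rfl
  · exact conjNormal_mem_relSub_iff_of_mem_K hg
  · obtain ⟨s⟩ := ‹Nonempty (U ⊕ I)›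
    have ha : g * (gen₂ s)⁻¹ ∈ P.K := by
      rw [← div_eq_mul_inv, MonoidHom.div_mem_ker_iff, twoDeg_gen₂]
      exact hg
    have conj_eq : MulAut.conjNormal g k =
        MulAut.conjNormal (g * (gen₂ s)⁻¹) (MulAut.conjNormal (gen₂ s) k) := by
      rw [← MulAut.mul_apply, ← map_mul, inv_mul_cancel_right]
    rw [conj_eq, conjNormal_mem_relSub_iff_of_mem_K ha, ← conjNormal_gen₂_mem_relSub_iff (i := 1) s,
      CharTwo.add_self_eq_zero]

end Conjugation

theorem ker_toAdd_twoDeg :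
    Setoid.ker (fun g => (twoDeg S₁ U I g).toAdd) = QuotientGroup.rightRel P.K := by
  ext g h
  rw [QuotientGroup.rightRel_apply, ← div_eq_mul_inv, MonoidHom.div_mem_ker_iff]
  exact eq_comm

theorem vertexSetoid_eq_rightRel [Nonempty (U ⊕ I)] :
    P.vertexSetoid = QuotientGroup.rightRel ((P.relSub 0).map P.K.subtype) := by
  ext g h
  rw [QuotientGroup.rightRel_apply]
  constructor
  · rintro ⟨i, -, hh, k, hk, hkgh⟩
    refine ⟨_, (conjNormal_mem_relSub_zero_iff hh).2 hk, ?_⟩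
    rw [Subgroup.subtype_apply, MulAut.conjNormal_apply, show (k : MF (S₁ ⊕ U) I) = _ from hkgh]
    group
  · rintro ⟨k, hk, hkgh⟩
    have hdeg : (twoDeg S₁ U I g).toAdd = (twoDeg S₁ U I h).toAdd :=
      (Setoid.ext_iff.1 P.ker_toAdd_twoDeg g h).2
        (QuotientGroup.rightRel_apply.2 (hkgh ▸ k.2))
    refine ⟨(twoDeg S₁ U I h).toAdd, hdeg, rfl, MulAut.conjNormal h⁻¹ k, ?_, ?_⟩
    · refine (conjNormal_mem_relSub_zero_iff rfl).1 ?_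
      rwa [← MulAut.mul_apply, ← map_mul, mul_inv_cancel, map_one]
    · rw [Subgroup.subtype_apply, MulAut.conjNormal_apply, show (k : MF (S₁ ⊕ U) I) = _ from hkgh]
      group

/-- The index `i` of the class `V_i` that contains a given vertex of the 2-partite Cayley graph. -/
def vertexLabel : P.Vert → ZMod 2 :=
  Quotient.lift (fun g => (twoDeg S₁ U I g).toAdd)
    fun _ _ ⟨_, hg, hh, _⟩ => Eq.trans hg (Eq.symm hh)

theorem vertexLabel_surjective [Nonempty (U ⊕ I)] : Function.Surjective P.vertexLabel := by
  obtain ⟨s⟩ := ‹Nonempty (U ⊕ I)›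
  intro i
  fin_cases i
  · exact ⟨P.vert 1, P.one_mem_treeClass⟩
  · exact ⟨P.vert (gen₂ s), P.gen₂_mem_treeClass s⟩

theorem vertexClass_eq_preimage (i : ZMod 2) : P.vertexClass i = P.vertexLabel ⁻¹' {i} :=
  Set.image_preimage_eq (P.vertexLabel ⁻¹' {i}) Quotient.mk_surjective

/-- Conjugation by a word in the class `Ṽ_i`, as an isomorphism from `G_i` to `G_0`. -/
def vertexGroupEquiv [Nonempty (U ⊕ I)] {P : TwoPartitePresentation S₁ U I} {i : ZMod 2}
    {p : MF (S₁ ⊕ U) I} (hp : p ∈ P.treeClass i) : P.VertexGroup i ≃* P.VertexGroup 0 :=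
  QuotientGroup.congr _ _ (MulAut.conjNormal p) <| by
    have comap_eq : (P.relSub 0).comap (MulAut.conjNormal p).toMonoidHom = P.relSub i :=
      Subgroup.ext fun _ => conjNormal_mem_relSub_zero_iff hp
    rw [← comap_eq]
    exact Subgroup.map_comap_eq_self_of_surjective (MulAut.conjNormal p).surjective _

theorem exists_vertexGroup_action [Nonempty (U ⊕ I)] {i : ZMod 2} {p : MF (S₁ ⊕ U) I}
    (hp : p ∈ P.treeClass i) :
    ∃ ι : P.VertexGroup i →* P.cayley.AutCol P.colour,
      Function.Injective ι ∧
      (∀ (g : P.K) (h : MF (S₁ ⊕ U) I),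
        (ι (QuotientGroup.mk g)).1 • P.vert h = P.vert (p * g * p⁻¹ * h)) ∧
      (∀ j : ZMod 2, ActsRegularlyOn
        (ι.range.map (P.cayley.AutCol P.colour).subtype) (P.vertexClass j)) ∧
      P.cayley.IsNCayleyOver
        (ι.range.map (P.cayley.AutCol P.colour).subtype) (2 : Cardinal.{0}) := by
  have hr := P.not_rel_gen
  have hN := P.vertexSetoid_eq_rightRel
  have hlabel := P.vertexLabel_surjective
  refine ⟨(MF.deckHom hr hN).comp (vertexGroupEquiv hp).toMonoidHom,
    (MF.deckHom_injective hr hN).comp (vertexGroupEquiv hp).injective,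
    fun g h => MF.deckHom_mk_smul hr hN (MulAut.conjNormal p g) h, fun j => ?_, ?_⟩
  · rw [vertexClass_eq_preimage]
    exact MF.actsRegularlyOn_range_deckHom_comp hr hN _ hlabel P.ker_toAdd_twoDeg j
  · have hcard : Cardinal.mk (ZMod 2) = 2 := by simp [Cardinal.mk_fintype]
    rw [← hcard]
    exact MF.isNCayleyOver_range_deckHom_comp hr hN _ hlabel P.ker_toAdd_twoDeg

end TwoPartitePresentation

theorem mainTheorem7 :
    -- partite presentations, with base class `b`; the tree vertex `p` lies above the class `x`
    (∀ (X : Type u) (U : Type v) (I : Type w) (P : PartitePresentation X U I) (b x : X),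
      ∀ p ∈ P.treeClass b x,
        ∃ ι : P.VertexGroup x →* (P.cayley b).AutCol (P.colour b),
          Function.Injective ι ∧
          (∀ (g : P.stab x) (h : MF U I),
            (ι (QuotientGroup.mk g)).1 • P.vert b h = P.vert b (p * g * p⁻¹ * h)) ∧
          (∀ y : X, ActsRegularlyOn
            (ι.range.map ((P.cayley b).AutCol (P.colour b)).subtype) (P.vertexClass b y)) ∧
          (P.cayley b).IsNCayleyOver
            (ι.range.map ((P.cayley b).AutCol (P.colour b)).subtype) (Cardinal.mk X)) ∧
    -- 2-partite presentations, with at least one generator in `S₂ = U ∪ I`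
    (∀ (S₁ : Type u) (U : Type v) (I : Type w) (P : TwoPartitePresentation S₁ U I),
      Nonempty (U ⊕ I) →
        (∀ i : ZMod 2, ∀ p ∈ P.treeClass i,
          ∃ ι : P.VertexGroup i →* P.cayley.AutCol P.colour,
            Function.Injective ι ∧
            (∀ (g : P.K) (h : MF (S₁ ⊕ U) I),
              (ι (QuotientGroup.mk g)).1 • P.vert h = P.vert (p * g * p⁻¹ * h)) ∧
            (∀ j : ZMod 2, ActsRegularlyOn
              (ι.range.map (P.cayley.AutCol P.colour).subtype) (P.vertexClass j)) ∧
            P.cayley.IsNCayleyOver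
              (ι.range.map (P.cayley.AutCol P.colour).subtype) (2 : Cardinal.{0})) ∧
        Nonempty (P.VertexGroup 0 ≃* P.VertexGroup 1) ∧
        P.cayley.IsBiCayley) := by
  refine ⟨fun _ _ _ P _ _ _ hp => P.exists_vertexGroup_action hp, fun _ _ _ P ⟨s⟩ => ?_⟩
  have : Nonempty (_ ⊕ _) := ⟨s⟩
  refine ⟨fun _ _ hp => P.exists_vertexGroup_action hp,
    ⟨(TwoPartitePresentation.vertexGroupEquiv (P.gen₂_mem_treeClass s)).symm⟩, ?_⟩
  obtain ⟨ι, -, -, -, hcayley⟩ := P.exists_vertexGroup_action P.one_mem_treeClass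
  exact ⟨_, hcayley⟩
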